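/- Let $\theta$ be an irrational real number, $\lambda=e^{2\pi i\theta}$, and let $\mathcal{O}(\mathbb{T}^2_\theta)$ be the complex $*$-algebra generated by unitaries $V,W$ subject to $VW=\lambda WV$. Let $\sigma$ be the algebra automorphism of $\mathcal{O}(\mathbb{T}^2_\theta)$ with $\sigma(V)=V^*$, $\sigma(W)=W^*$, and put $\mathcal{O}(\mathbb{P}_\theta)=\{a:\sigma(a)=a\}$ (the noncommutative pillow algebra) and $\mathcal{O}(\mathbb{T}^2_\theta)_-=\{a:\sigma(a)=-a\}$, a left and right $\mathcal{O}(\mathbb{P}_\theta)$-module by multiplication. Then: 1. $\mathcal{O}(\mathbb{T}^2_\theta)_-$ is finitely generated and projective, but not free, both as a left and as a right $\mathcal{O}(\mathbb{P}_\theta)$-module. 2. Let $\hat x=V-V^*$, $\hat y=W-W^*$, $\hat z=VW^*-V^*W$, $z=VW^*+V^*W$. The matrix $$\mathbf e=\frac{1}{2(\bar\lambda^2-1)}\begin{pmatrix}\hat x\\ \hat y\\ \hat z\end{pmatrix}\begin{pmatrix}\hat x,& \hat y-\hat xz,& -\bar\lambda\hat z\end{pmatrix}$$ is an idempotent $3\times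 3$ matrix over $\mathcal{O}(\mathbb{P}_\theta)$, and $\mathcal{O}(\mathbb{T}^2_\theta)_-\cong\mathcal{O}(\mathbb{P}_\theta)^3\,\mathbf e$ as left modules and $\mathcal{O}(\mathbb{T}^2_\theta)_-\cong\mathbf e\,\mathcal{O}(\mathbb{P}_\theta)^3$ as right modules. 3. For $i,j\in\{0,1\}$ there is a unique linear functional $\hat\tau_{ij}$ on $\mathcal{O}(\mathbb{T}^2_\theta)$ such that, for all $\alpha,\beta\in\mathbb{Z}$, $\hat\tau_{ij}(V^\alpha W^\beta)=e^{\pi i\theta\alpha\beta}$ if $\alpha\equiv i$ and $\beta\equiv j$ modulo $2$, and $\hat\tau_{ij}(V^\alpha W^\beta)=0$ otherwise. It is a twisted trace, i.e. $\hat\tau_{ij}(ab)=\hat\tau_{ij}(\sigma(b)a)$ for all $a,b$, and $$\hat\tau_{00}(\operatorname{Tr}\mathbf e)=-1,\qquad \hat\tau_{01}(\operatorname{Tr}\mathbf e)=\hat\tau_{10}(\operatorname{Tr}\mathbf e)=\hat\tau_{11}(\operatorname{Tr}\mathbf e)=0 .$$ 4. The module of one-forms $\Omega^1(\mathbb{P}_\theta)=\mathcal{O}(\mathbb{T}^2_\theta)_-\oplus\mathcal{O}(\mathbb{T}^2_\theta)_-$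 (the sections of the cotangent bundle of $\mathbb{P}_\theta$) is non-trivial: it is not free, neither as a left nor as a right $\mathcal{O}(\mathbb{P}_\theta)$-module. -/

import Mathlib

namespace NCPillow

noncomputable section

/-- The deformation parameter `λ = exp(2πiθ)`. -/
def lam (θ : ℝ) : ℂ := Complex.exp (2 * Real.pi * Complex.I * θ)

/-- Letters for the unitaries `V`, `W` and their adjoints. -/
inductive Gen : Type
  | V
  | Vs
  | W
  | Ws

/-- Defining relations of the noncommutative torus: `V V* = V* V = 1`, `W W* = W* W = 1` and
`V W = λ W V`. -/
inductive Rel (θ : ℝ) : FreeAlgebra ℂ Gen → FreeAlgebra ℂ Gen → Prop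
  | V_mul_Vs : Rel θ (FreeAlgebra.ι ℂ Gen.V * FreeAlgebra.ι ℂ Gen.Vs) 1
  | Vs_mul_V : Rel θ (FreeAlgebra.ι ℂ Gen.Vs * FreeAlgebra.ι ℂ Gen.V) 1
  | W_mul_Ws : Rel θ (FreeAlgebra.ι ℂ Gen.W * FreeAlgebra.ι ℂ Gen.Ws) 1
  | Ws_mul_W : Rel θ (FreeAlgebra.ι ℂ Gen.Ws * FreeAlgebra.ι ℂ Gen.W) 1
  | V_mul_W : Rel θ (FreeAlgebra.ι ℂ Gen.V * FreeAlgebra.ι ℂ Gen.W)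
      (lam θ • (FreeAlgebra.ι ℂ Gen.W * FreeAlgebra.ι ℂ Gen.V))

/-- The coordinate algebra `𝒪(𝕋²_θ)` of the noncommutative torus. The `*`-conjugate of the relation
`V W = λ W V` follows from the other relations, so this is the algebra underlying the universal
`*`-algebra generated by unitaries `V`, `W` with `V W = λ W V`; the involution is determined by
`V* = V⁻¹`, `W* = W⁻¹`. -/
def Torus (θ : ℝ) : Type := RingQuot (Rel θ)

instance torusRing (θ : ℝ) : Ring (Torus θ) := inferInstanceAs (Ring (RingQuot (Rel θ)))

instance torusAlgebra (θ : ℝ) : Algebra ℂ (Torus θ) :=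
  inferInstanceAs (Algebra ℂ (RingQuot (Rel θ)))

/-- The quotient map from the free algebra onto the noncommutative torus. -/
def mk (θ : ℝ) : FreeAlgebra ℂ Gen →ₐ[ℂ] Torus θ := RingQuot.mkAlgHom ℂ (Rel θ)

theorem mk_rel {θ : ℝ} {x y : FreeAlgebra ℂ Gen} (h : Rel θ x y) : mk θ x = mk θ y :=
  RingQuot.mkAlgHom_rel ℂ h

/-- An algebra map out of the noncommutative torus is given by images of the letters that satisfy
the defining relations. -/
def lift {B : Type*} [Ring B] [Algebra ℂ B] (θ : ℝ) (f : Gen → B)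
    (hf : ∀ ⦃x y : FreeAlgebra ℂ Gen⦄, Rel θ x y → FreeAlgebra.lift ℂ f x = FreeAlgebra.lift ℂ f y) :
    Torus θ →ₐ[ℂ] B :=
  RingQuot.liftAlgHom ℂ (s := Rel θ) ⟨FreeAlgebra.lift ℂ f, hf⟩

/-- The image of a letter in the noncommutative torus. -/
def gen (θ : ℝ) (g : Gen) : Torus θ := mk θ (FreeAlgebra.ι ℂ g)

theorem lift_gen {B : Type*} [Ring B] [Algebra ℂ B] (θ : ℝ) (f : Gen → B)
    (hf : ∀ ⦃x y : FreeAlgebra ℂ Gen⦄, Rel θ x y → FreeAlgebra.lift ℂ f x = FreeAlgebra.lift ℂ f y)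
    (g : Gen) : lift θ f hf (gen θ g) = f g :=
  (RingQuot.liftAlgHom_mkAlgHom_apply ℂ (FreeAlgebra.lift ℂ f) hf (FreeAlgebra.ι ℂ g)).trans
    (FreeAlgebra.lift_ι_apply f g)

theorem gen_V_Vs (θ : ℝ) : gen θ Gen.V * gen θ Gen.Vs = 1 := by
  simpa [gen] using mk_rel (Rel.V_mul_Vs (θ := θ))

theorem gen_Vs_V (θ : ℝ) : gen θ Gen.Vs * gen θ Gen.V = 1 := by
  simpa [gen] using mk_rel (Rel.Vs_mul_V (θ := θ))

theorem gen_W_Ws (θ : ℝ) : gen θ Gen.W * gen θ Gen.Ws = 1 := by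
  simpa [gen] using mk_rel (Rel.W_mul_Ws (θ := θ))

theorem gen_Ws_W (θ : ℝ) : gen θ Gen.Ws * gen θ Gen.W = 1 := by
  simpa [gen] using mk_rel (Rel.Ws_mul_W (θ := θ))

theorem gen_V_W (θ : ℝ) : gen θ Gen.V * gen θ Gen.W = lam θ • (gen θ Gen.W * gen θ Gen.V) := by
  simpa [gen] using mk_rel (Rel.V_mul_W (θ := θ))

/-- The unitary generator `V`, as a unit; `V* = V⁻¹`. -/
def V (θ : ℝ) : (Torus θ)ˣ := ⟨gen θ Gen.V, gen θ Gen.Vs, gen_V_Vs θ, gen_Vs_V θ⟩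

/-- The unitary generator `W`, as a unit; `W* = W⁻¹`. -/
def W (θ : ℝ) : (Torus θ)ˣ := ⟨gen θ Gen.W, gen θ Gen.Ws, gen_W_Ws θ, gen_Ws_W θ⟩

theorem gen_Vs_Ws (θ : ℝ) :
    gen θ Gen.Vs * gen θ Gen.Ws = lam θ • (gen θ Gen.Ws * gen θ Gen.Vs) := by
  have h : ((V θ * W θ : (Torus θ)ˣ) : Torus θ) = lam θ • ((W θ * V θ : (Torus θ)ˣ) : Torus θ) :=
    gen_V_W θ
  have h1 : (((W θ * V θ)⁻¹ : (Torus θ)ˣ) : Torus θ)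
      = lam θ • (((V θ * W θ)⁻¹ : (Torus θ)ˣ) : Torus θ) := by
    calc (((W θ * V θ)⁻¹ : (Torus θ)ˣ) : Torus θ)
        = ((W θ * V θ)⁻¹ : (Torus θ)ˣ) * ((V θ * W θ : (Torus θ)ˣ) : Torus θ)
            * (((V θ * W θ)⁻¹ : (Torus θ)ˣ) : Torus θ) := by
          rw [mul_assoc, Units.mul_inv, mul_one]
      _ = _ := by
          rw [h, mul_smul_comm, Units.inv_mul, smul_mul_assoc, one_mul]
  rw [mul_inv_rev, mul_inv_rev] at h1
  exact h1

/-- The interchange of `V` with `V*` and of `W` with `W*` on letters. -/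
def Gen.swap : Gen → Gen
  | Gen.V => Gen.Vs
  | Gen.Vs => Gen.V
  | Gen.W => Gen.Ws
  | Gen.Ws => Gen.W

/-- The algebra map `σ` of the noncommutative torus with `σ(V) = V*`, `σ(W) = W*`. -/
def sigma (θ : ℝ) : Torus θ →ₐ[ℂ] Torus θ :=
  lift θ (fun g => gen θ g.swap) (by
    intro x y h
    cases h <;>
      simp [Gen.swap, gen_V_Vs, gen_Vs_V, gen_W_Ws, gen_Ws_W, gen_Vs_Ws])

/-- The coordinate algebra `𝒪(ℙ_θ) = 𝒪(𝕋²_θ)₊` of the noncommutative pillow: the fixed points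
of `σ`. -/
def Pillow (θ : ℝ) : Subalgebra ℂ (Torus θ) := AlgHom.equalizer (sigma θ) (AlgHom.id ℂ (Torus θ))

theorem mem_pillow {θ : ℝ} {a : Torus θ} : a ∈ Pillow θ ↔ sigma θ a = a := Iff.rfl

/-- The odd part `𝒪(𝕋²_θ)₋ = {a | σ(a) = -a}`. -/
def OddPart (θ : ℝ) : Submodule ℂ (Torus θ) where
  carrier := {a | sigma θ a = -a}
  add_mem' {a b} ha hb := by
    change sigma θ (a + b) = -(a + b)
    change sigma θ a = -a at ha
    change sigma θ b = -b at hb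
    rw [map_add, ha, hb, neg_add]
  zero_mem' := by simp
  smul_mem' c a ha := by
    change sigma θ (c • a) = -(c • a)
    change sigma θ a = -a at ha
    rw [map_smul, ha, smul_neg]

theorem mem_odd {θ : ℝ} {a : Torus θ} : a ∈ OddPart θ ↔ sigma θ a = -a := Iff.rfl

theorem pillow_mul_odd {θ : ℝ} {p a : Torus θ} (hp : p ∈ Pillow θ) (ha : a ∈ OddPart θ) :
    p * a ∈ OddPart θ := by
  rw [mem_pillow] at hp
  rw [mem_odd] at ha ⊢
  rw [map_mul, hp, ha, mul_neg]

theorem odd_mul_pillow {θ : ℝ} {p a : Torus θ} (hp : p ∈ Pillow θ) (ha : a ∈ OddPart θ) :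
    a * p ∈ OddPart θ := by
  rw [mem_pillow] at hp
  rw [mem_odd] at ha ⊢
  rw [map_mul, hp, ha, neg_mul]

theorem odd_mul_odd {θ : ℝ} {a b : Torus θ} (ha : a ∈ OddPart θ) (hb : b ∈ OddPart θ) :
    a * b ∈ Pillow θ := by
  rw [mem_odd] at ha hb
  rw [mem_pillow, map_mul, ha, hb, neg_mul_neg]

/-- `𝒪(𝕋²_θ)₋` as a left `𝒪(ℙ_θ)`-module: `p • a = p a`. -/
instance leftModule (θ : ℝ) : Module (Pillow θ) (OddPart θ) where
  smul p a := ⟨(p : Torus θ) * (a : Torus θ), pillow_mul_odd p.2 a.2⟩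
  one_smul a := Subtype.ext (one_mul (a : Torus θ))
  mul_smul p q a := Subtype.ext (mul_assoc (p : Torus θ) (q : Torus θ) (a : Torus θ))
  smul_zero p := Subtype.ext (mul_zero (p : Torus θ))
  smul_add p a b := Subtype.ext (mul_add (p : Torus θ) (a : Torus θ) (b : Torus θ))
  add_smul p q a := Subtype.ext (add_mul (p : Torus θ) (q : Torus θ) (a : Torus θ))
  zero_smul a := Subtype.ext (zero_mul (a : Torus θ))

/-- `𝒪(𝕋²_θ)₋` as a right `𝒪(ℙ_θ)`-module, i.e. a module over the opposite algebra:
`op p • a = a p`. -/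
instance rightModule (θ : ℝ) : Module (Pillow θ)ᵐᵒᵖ (OddPart θ) where
  smul p a := ⟨(a : Torus θ) * (p.unop : Torus θ), odd_mul_pillow p.unop.2 a.2⟩
  one_smul a := Subtype.ext (mul_one (a : Torus θ))
  mul_smul p q a :=
    Subtype.ext (mul_assoc (a : Torus θ) (q.unop : Torus θ) (p.unop : Torus θ)).symm
  smul_zero p := Subtype.ext (zero_mul (p.unop : Torus θ))
  smul_add p a b := Subtype.ext (add_mul (a : Torus θ) (b : Torus θ) (p.unop : Torus θ))
  add_smul p q a := Subtype.ext (mul_add (a : Torus θ) (p.unop : Torus θ) (q.unop : Torus θ))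
  zero_smul a := Subtype.ext (mul_zero (a : Torus θ))

/-- The module of one-forms (sections of the cotangent bundle)
`Ω¹(ℙ_θ) = 𝒪(𝕋²_θ)₋ ⊕ 𝒪(𝕋²_θ)₋`, with the componentwise left and right actions. -/
abbrev Omega1 (θ : ℝ) : Type := OddPart θ × OddPart θ

theorem sigma_gen (θ : ℝ) (g : Gen) : sigma θ (gen θ g) = gen θ g.swap :=
  lift_gen θ _ _ g

theorem sigma_V (θ : ℝ) : sigma θ (V θ : Torus θ) = ((V θ)⁻¹ : (Torus θ)ˣ) := sigma_gen θ Gen.V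

theorem sigma_V_inv (θ : ℝ) : sigma θ (((V θ)⁻¹ : (Torus θ)ˣ) : Torus θ) = V θ :=
  sigma_gen θ Gen.Vs

theorem sigma_W (θ : ℝ) : sigma θ (W θ : Torus θ) = ((W θ)⁻¹ : (Torus θ)ˣ) := sigma_gen θ Gen.W

theorem sigma_W_inv (θ : ℝ) : sigma θ (((W θ)⁻¹ : (Torus θ)ˣ) : Torus θ) = W θ :=
  sigma_gen θ Gen.Ws

/-- `z = V W* + V* W`. -/
def z (θ : ℝ) : Pillow θ :=
  ⟨(V θ : Torus θ) * ((W θ)⁻¹ : (Torus θ)ˣ) + ((V θ)⁻¹ : (Torus θ)ˣ) * (W θ : Torus θ), by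
    rw [mem_pillow, map_add, map_mul, map_mul, sigma_V, sigma_W_inv, sigma_V_inv, sigma_W,
      add_comm]⟩

/-- `x̂ = V - V*`. -/
def xHat (θ : ℝ) : OddPart θ :=
  ⟨(V θ : Torus θ) - ((V θ)⁻¹ : (Torus θ)ˣ), by
    rw [mem_odd, map_sub, sigma_V, sigma_V_inv, neg_sub]⟩

/-- `ŷ = W - W*`. -/
def yHat (θ : ℝ) : OddPart θ :=
  ⟨(W θ : Torus θ) - ((W θ)⁻¹ : (Torus θ)ˣ), by
    rw [mem_odd, map_sub, sigma_W, sigma_W_inv, neg_sub]⟩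

/-- `ẑ = V W* - V* W`. -/
def zHat (θ : ℝ) : OddPart θ :=
  ⟨(V θ : Torus θ) * ((W θ)⁻¹ : (Torus θ)ˣ) - ((V θ)⁻¹ : (Torus θ)ˣ) * (W θ : Torus θ), by
    rw [mem_odd, map_sub, map_mul, map_mul, sigma_V, sigma_W_inv, sigma_V_inv, sigma_W, neg_sub]⟩

/-- The product of two odd elements, as an element of the pillow algebra. -/
def oddMul {θ : ℝ} (a b : OddPart θ) : Pillow θ :=
  ⟨(a : Torus θ) * (b : Torus θ), odd_mul_odd a.2 b.2⟩

/-- The column `(x̂, ŷ, ẑ)ᵀ`. -/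
def col (θ : ℝ) : Fin 3 → OddPart θ := ![xHat θ, yHat θ, zHat θ]

/-- The row `(x̂, ŷ - x̂ z, -λ̄ ẑ)`. -/
def row (θ : ℝ) : Fin 3 → OddPart θ :=
  ![xHat θ, yHat θ - MulOpposite.op (z θ) • xHat θ, -((starRingEnd ℂ) (lam θ) • zHat θ)]

/-- The `3 × 3` matrix `e = (2(λ̄² - 1))⁻¹ (x̂, ŷ, ẑ)ᵀ (x̂, ŷ - x̂ z, -λ̄ ẑ)` over `𝒪(ℙ_θ)`. -/
def e (θ : ℝ) : Matrix (Fin 3) (Fin 3) (Pillow θ) :=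
  Matrix.of fun i j =>
    (1 / (2 * ((starRingEnd ℂ) (lam θ) ^ 2 - 1))) • oddMul (col θ i) (row θ j)

/-- The left submodule `𝒪(ℙ_θ)³ e` of the free left module of row vectors. -/
def leftImage (θ : ℝ) : Submodule (Pillow θ) (Fin 3 → Pillow θ) where
  carrier := {w | ∃ v : Fin 3 → Pillow θ, w = Matrix.vecMul v (e θ)}
  add_mem' := by
    rintro _ _ ⟨v, rfl⟩ ⟨w, rfl⟩
    exact ⟨v + w, (Matrix.add_vecMul _ _ _).symm⟩
  zero_mem' := ⟨0, (Matrix.zero_vecMul _).symm⟩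
  smul_mem' := by
    rintro p _ ⟨v, rfl⟩
    exact ⟨p • v, (Matrix.smul_vecMul _ _ _).symm⟩

/-- The right submodule `e 𝒪(ℙ_θ)³` of the free right module of column vectors. -/
def rightImage (θ : ℝ) : Submodule (Pillow θ)ᵐᵒᵖ (Fin 3 → Pillow θ) where
  carrier := {w | ∃ v : Fin 3 → Pillow θ, w = Matrix.mulVec (e θ) v}
  add_mem' := by
    rintro _ _ ⟨v, rfl⟩ ⟨w, rfl⟩
    exact ⟨v + w, (Matrix.mulVec_add _ _ _).symm⟩
  zero_mem' := ⟨0, (Matrix.mulVec_zero _).symm⟩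
  smul_mem' := by
    rintro p _ ⟨v, rfl⟩
    exact ⟨p • v, (Matrix.mulVec_smul _ _ _).symm⟩

/-- `τ` takes the values `τ(V^α W^β) = exp(πiθαβ)` if `α ≡ i` and `β ≡ j` modulo `2`, and `0`
otherwise. -/
def HasTraceValues (θ : ℝ) (i j : ZMod 2) (τ : Torus θ →ₗ[ℂ] ℂ) : Prop :=
  ∀ α β : ℤ, τ ((V θ ^ α * W θ ^ β : (Torus θ)ˣ) : Torus θ) =
    if (α : ZMod 2) = i ∧ (β : ZMod 2) = j then
      Complex.exp (Real.pi * Complex.I * θ * α * β) else 0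

end

end NCPillow

/-!
The entries of `row` and `col` are odd and `∑ k, row k * col k = 2 (λ̄² - 1)`, so dividing the row
by this scalar gives odd elements with `1 = ∑ k, normRow k * col k`. Multiplying this identity by an
odd element on either side expands that element over the pillow algebra: `col` and `normRow` yield a
dual basis of the odd part as a left and as a right module, and `e` is the associated idempotent.
In `∑ k, col k * normRow k`, the trace of `e`, a twisted trace interchanges the two odd factors at
the cost of a sign, so `τ̂(Tr e) = -τ̂(1)`.

On the pillow algebra `τ̂₀₀` is an ordinary trace with `τ̂₀₀(1) = 1`. The trace of the idempotent
of a finitely generated projective module depends only on the module, and is a natural number for a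
free one; here it is `-1` for the odd part and `-2` for its double.
-/

namespace NCPillow

noncomputable section

section DualBasis

variable {R M N ι κ A : Type*} [Semiring R] [AddCommMonoid M] [Module R M]
  [AddCommMonoid N] [Module R N] [Fintype ι] [Fintype κ]

/-- The families `x` in `M` and `φ` in the dual of `M` form a finite dual basis: every `m` equals
`∑ i, φ i m • x i`. The expansion need not be unique, so `x` is not a basis in general. -/
def IsDualBasis (x : ι → M) (φ : ι → M →ₗ[R] R) : Prop :=
  ∀ m, ∑ i, φ i m • x i = m

namespace IsDualBasis

variable {x : ι → M} {φ : ι → M →ₗ[R] R} {y : κ → M} {ψ : κ → M →ₗ[R] R}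

theorem finite (h : IsDualBasis x φ) : Module.Finite R M :=
  .of_surjective (Fintype.linearCombination R x) fun m => ⟨fun i => φ i m, h m⟩

theorem projective (h : IsDualBasis x φ) : Module.Projective R M :=
  .of_split (LinearMap.pi φ) (Fintype.linearCombination R x) (LinearMap.ext h)

theorem of_basis (b : Module.Basis ι R M) : IsDualBasis b b.coord :=
  b.sum_repr

theorem prod {x' : κ → N} {φ' : κ → N →ₗ[R] R} (h : IsDualBasis x φ) (h' : IsDualBasis x' φ') :
    IsDualBasis (Sum.elim (fun i => (x i, 0)) fun j => (0, x' j))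
      (Sum.elim (fun i => φ i ∘ₗ LinearMap.fst R M N) fun j => φ' j ∘ₗ LinearMap.snd R M N) := by
  intro m
  ext <;> simp [Prod.fst_sum, Prod.snd_sum, h m.1, h' m.2]

section Trace

variable [AddCommMonoid A] {t : R →+ A}

/-- Well-definedness of the Hattori–Stallings rank. -/
theorem sum_trace_eq (h : IsDualBasis x φ) (k : IsDualBasis y ψ)
    (ht : ∀ a b, t (a * b) = t (b * a)) : ∑ i, t (φ i (x i)) = ∑ j, t (ψ j (y j)) := by
  have expand_x (i : ι) : t (φ i (x i)) = ∑ j, t (ψ j (x i) * φ i (y j)) := by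
    conv_lhs => rw [← k (x i)]
    simp
  have expand_y (j : κ) : t (ψ j (y j)) = ∑ i, t (φ i (y j) * ψ j (x i)) := by
    conv_lhs => rw [← h (y j)]
    simp
  simp only [expand_x, expand_y]
  rw [Finset.sum_comm]
  simp only [ht]

theorem exists_sum_trace_eq_nsmul [Module.Free R M] (h : IsDualBasis x φ)
    (ht : ∀ a b, t (a * b) = t (b * a)) : ∃ n : ℕ, ∑ i, t (φ i (x i)) = n • t 1 := by
  have := h.finite
  let b := Module.Free.chooseBasis R M
  refine ⟨Fintype.card (Module.Free.ChooseBasisIndex R M), ?_⟩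
  rw [h.sum_trace_eq (of_basis b) ht]
  simp

variable [PartialOrder A] [IsOrderedAddMonoid A]

theorem not_free_of_sum_trace_neg (h : IsDualBasis x φ) (ht : ∀ a b, t (a * b) = t (b * a))
    (t_one : 0 ≤ t 1) (hx : ∑ i, t (φ i (x i)) < 0) : ¬ Module.Free R M := by
  intro _
  obtain ⟨n, hn⟩ := h.exists_sum_trace_eq_nsmul ht
  exact (nsmul_nonneg t_one n).not_gt (hn ▸ hx)

theorem not_free_prod_of_sum_trace_neg (h : IsDualBasis x φ) (ht : ∀ a b, t (a * b) = t (b * a))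
    (t_one : 0 ≤ t 1) (hx : ∑ i, t (φ i (x i)) < 0) : ¬ Module.Free R (M × M) :=
  (h.prod h).not_free_of_sum_trace_neg ht t_one (by
    simpa using (add_le_of_nonpos_left hx.le).trans_lt hx)

end Trace

end IsDualBasis

theorem nonempty_linearEquiv_of_leftInverse {f : M →ₗ[R] N} {g : N → M}
    (hgf : Function.LeftInverse g f) {S : Submodule R N} (hS : ∀ w, w ∈ S ↔ ∃ v, w = f (g v)) :
    Nonempty (M ≃ₗ[R] S) := by
  have range_eq : LinearMap.range f = S := by
    ext w
    rw [hS, LinearMap.mem_range]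
    constructor
    · rintro ⟨m, rfl⟩
      exact ⟨f m, by rw [hgf]⟩
    · rintro ⟨v, rfl⟩
      exact ⟨g v, rfl⟩
  exact ⟨(LinearEquiv.ofInjective f hgf.injective).trans (LinearEquiv.ofEq _ _ range_eq)⟩

end DualBasis

theorem zpow_mul_zpow_of_mul_eq {G : Type*} [Group G] {v w c : G} (hcv : Commute c v)
    (hcw : Commute c w) (h : v * w = c * (w * v)) (a b : ℤ) :
    w ^ b * v ^ a = c ^ (-(a * b)) * (v ^ a * w ^ b) := by
  have hv : SemiconjBy v (w ^ b) (c ^ b * w ^ b) := by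
    rw [← hcw.mul_zpow]
    exact SemiconjBy.zpow_right (h.trans (mul_assoc c w v).symm) b
  have hw : SemiconjBy (w ^ b) v (c ^ (-b) * v) := by
    rw [SemiconjBy, mul_assoc, hv.eq]
    group
  rw [(hw.zpow_right a).eq, (hcv.zpow_left _).mul_zpow, ← zpow_mul, mul_assoc, neg_mul,
    mul_comm b]

theorem map_units_zpow_of_map_add {A B : Type*} [Monoid A] [Monoid B] (f : A →* B) {s : ℤ → B}
    (map_zero : s 0 = 1) (map_add : ∀ m n, s (m + n) = s m * s n) {v : Aˣ} (hv : f v = s 1)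
    (n : ℤ) : f (v ^ n : Aˣ) = s n := by
  let S : Multiplicative ℤ →* B :=
    { toFun n := s n.toAdd
      map_one' := map_zero
      map_mul' := fun m n => map_add m.toAdd n.toAdd }
  have eq_S : f.comp ((Units.coeHom A).comp (zpowersHom Aˣ v)) = S :=
    MonoidHom.ext_mint (by simpa [S] using hv)
  simpa [S] using DFunLike.congr_fun eq_S (Multiplicative.ofAdd n)

section Parameter

theorem lam_ne_zero (θ : ℝ) : lam θ ≠ 0 := Complex.exp_ne_zero _

theorem lam_zpow (θ : ℝ) (n : ℤ) : lam θ ^ n = Complex.exp (2 * Real.pi * Complex.I * θ * n) := by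
  rw [lam, ← Complex.exp_int_mul, mul_comm]

theorem conj_lam (θ : ℝ) : (starRingEnd ℂ) (lam θ) = (lam θ)⁻¹ := by
  rw [lam, ← Complex.exp_conj, ← Complex.exp_neg]
  simp [Complex.conj_ofNat]

theorem lam_sq_ne_one {θ : ℝ} (hθ : Irrational θ) : lam θ ^ 2 ≠ 1 := by
  intro h
  rw [← zpow_ofNat, lam_zpow, Complex.exp_eq_one_iff] at h
  obtain ⟨n, hn⟩ := h
  have two_mul_eq : (θ * (2 : ℕ) : ℂ) = n := by
    apply mul_left_cancel₀ Complex.two_pi_I_ne_zero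
    push_cast at hn ⊢
    linear_combination hn
  exact (hθ.mul_natCast two_ne_zero).ne_int n (by exact_mod_cast two_mul_eq)

end Parameter

section Monomials

variable (θ : ℝ)

/-- The monomials `V^α W^β`, which form a basis of the noncommutative torus. -/
def monomial (α β : ℤ) : Torus θ := ((V θ ^ α * W θ ^ β : (Torus θ)ˣ) : Torus θ)

theorem monomial_zero : monomial θ 0 0 = 1 := by simp [monomial]

theorem coe_V : (V θ : Torus θ) = monomial θ 1 0 := by simp [monomial]

theorem coe_V_inv : (((V θ)⁻¹ : (Torus θ)ˣ) : Torus θ) = monomial θ (-1) 0 := by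
  simp [monomial]

theorem coe_W : (W θ : Torus θ) = monomial θ 0 1 := by simp [monomial]

theorem coe_W_inv : (((W θ)⁻¹ : (Torus θ)ˣ) : Torus θ) = monomial θ 0 (-1) := by
  simp [monomial]

theorem exists_gen_eq_monomial : ∀ g, ∃ a b, gen θ g = monomial θ a b
  | .V => ⟨1, 0, coe_V θ⟩
  | .Vs => ⟨-1, 0, coe_V_inv θ⟩
  | .W => ⟨0, 1, coe_W θ⟩
  | .Ws => ⟨0, -1, coe_W_inv θ⟩

theorem W_zpow_mul_V_zpow (α β : ℤ) :
    ((W θ ^ β * V θ ^ α : (Torus θ)ˣ) : Torus θ) = lam θ ^ (-(α * β)) • monomial θ α β := by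
  let c : (Torus θ)ˣ := Units.map (algebraMap ℂ (Torus θ)) (Units.mk0 (lam θ) (lam_ne_zero θ))
  have c_central (u : (Torus θ)ˣ) : Commute c u :=
    Units.ext (Algebra.commutes (lam θ) (u : Torus θ))
  have V_mul_W : V θ * W θ = c * (W θ * V θ) :=
    Units.ext ((gen_V_W θ).trans (Algebra.smul_def _ _))
  have coe_c_zpow (n : ℤ) : ((c ^ n : (Torus θ)ˣ) : Torus θ) = algebraMap ℂ _ (lam θ ^ n) := by
    rw [← map_zpow, Units.coe_map]
    simp
  rw [zpow_mul_zpow_of_mul_eq (c_central _) (c_central _) V_mul_W, Units.val_mul, coe_c_zpow,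
    Algebra.smul_def, monomial]

theorem monomial_mul_monomial (a b c d : ℤ) :
    monomial θ a b * monomial θ c d = lam θ ^ (-(c * b)) • monomial θ (a + c) (b + d) := by
  calc monomial θ a b * monomial θ c d
      = ↑(V θ ^ a) * ↑(W θ ^ b * V θ ^ c) * ↑(W θ ^ d) := by
        simp only [monomial, Units.val_mul, mul_assoc]
    _ = lam θ ^ (-(c * b)) • ↑(V θ ^ a * (V θ ^ c * W θ ^ b) * W θ ^ d) := by
        rw [W_zpow_mul_V_zpow]
        simp only [mul_smul_comm, smul_mul_assoc, monomial, Units.val_mul]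
    _ = lam θ ^ (-(c * b)) • monomial θ (a + c) (b + d) := by
        rw [monomial, zpow_add, zpow_add]
        simp only [mul_assoc]

theorem sigma_monomial (a b : ℤ) : sigma θ (monomial θ a b) = monomial θ (-a) (-b) := by
  have map_V : Units.map (sigma θ : Torus θ →* Torus θ) (V θ) = (V θ)⁻¹ := Units.ext (sigma_V θ)
  have map_W : Units.map (sigma θ : Torus θ →* Torus θ) (W θ) = (W θ)⁻¹ := Units.ext (sigma_W θ)
  have map_V_mul_W : Units.map (sigma θ : Torus θ →* Torus θ) (V θ ^ a * W θ ^ b)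
      = V θ ^ (-a) * W θ ^ (-b) := by
    rw [map_mul, map_zpow, map_zpow, map_V, map_W, inv_zpow', inv_zpow']
  exact congrArg Units.val map_V_mul_W

theorem adjoin_range_gen : Algebra.adjoin ℂ (Set.range (gen θ)) = ⊤ := by
  have mk_surjective : Function.Surjective (mk θ) := RingQuot.mkAlgHom_surjective ℂ (Rel θ)
  have range_gen : Set.range (gen θ) = mk θ '' Set.range (FreeAlgebra.ι ℂ) :=
    Set.range_comp _ _
  rw [range_gen, ← AlgHom.map_adjoin, FreeAlgebra.adjoin_range_ι, Algebra.map_top,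
    (mk θ).range_eq_top.2 mk_surjective]

theorem span_monomial :
    Submodule.span ℂ (Set.range fun p : ℤ × ℤ => monomial θ p.1 p.2) = ⊤ := by
  set S := Submodule.span ℂ (Set.range fun p : ℤ × ℤ => monomial θ p.1 p.2)
  have monomial_mem (a b : ℤ) : monomial θ a b ∈ S := Submodule.subset_span ⟨(a, b), rfl⟩
  have mul_le : S * S ≤ S := by
    rw [Submodule.span_mul_span, Submodule.span_le]
    rintro _ ⟨_, ⟨p, rfl⟩, _, ⟨q, rfl⟩, rfl⟩
    simp only [monomial_mul_monomial]
    exact S.smul_mem _ (monomial_mem _ _)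
  let A : Subalgebra ℂ (Torus θ) := S.toSubalgebra (monomial_zero θ ▸ monomial_mem 0 0)
    fun _ _ hx hy => mul_le (Submodule.mul_mem_mul hx hy)
  have adjoin_le : Algebra.adjoin ℂ (Set.range (gen θ)) ≤ A := by
    rw [Algebra.adjoin_le_iff]
    rintro _ ⟨g, rfl⟩
    obtain ⟨a, b, gen_eq⟩ := exists_gen_eq_monomial θ g
    rw [gen_eq]
    exact monomial_mem a b
  rw [adjoin_range_gen] at adjoin_le
  exact eq_top_iff.2 fun x _ => adjoin_le (Algebra.mem_top (x := x))

/-- Left multiplication by `V^α W^β` on the space with basis `δ (m, n)`, where `δ (m, n)` plays the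
role of `V^m W^n`. -/
def monomialAction (α β : ℤ) : Module.End ℂ (ℤ × ℤ →₀ ℂ) :=
  Finsupp.linearCombination ℂ fun p => Finsupp.single (α + p.1, β + p.2) (lam θ ^ (-(p.1 * β)))

theorem monomialAction_single (α β m n : ℤ) (c : ℂ) :
    monomialAction θ α β (Finsupp.single (m, n) c)
      = Finsupp.single (α + m, β + n) (c * lam θ ^ (-(m * β))) := by
  simp [monomialAction]

theorem monomialAction_mul (a b c d : ℤ) :
    monomialAction θ a b * monomialAction θ c d
      = lam θ ^ (-(c * b)) • monomialAction θ (a + c) (b + d) := by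
  refine Finsupp.basisSingleOne.ext fun ⟨m, n⟩ => ?_
  simp only [Finsupp.coe_basisSingleOne, Module.End.mul_apply, LinearMap.smul_apply,
    monomialAction_single, Finsupp.smul_single, smul_eq_mul, one_mul, add_assoc,
    ← zpow_add₀ (lam_ne_zero θ)]
  ring_nf

theorem monomialAction_zero : monomialAction θ 0 0 = 1 :=
  Finsupp.basisSingleOne.ext fun _ => by simp [monomialAction]

/-- The left regular representation of the noncommutative torus in the coordinates given by the
monomials; it is what shows that they are linearly independent. -/
def regularRep : Torus θ →ₐ[ℂ] Module.End ℂ (ℤ × ℤ →₀ ℂ) :=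
  lift θ (fun
    | Gen.V => monomialAction θ 1 0
    | Gen.Vs => monomialAction θ (-1) 0
    | Gen.W => monomialAction θ 0 1
    | Gen.Ws => monomialAction θ 0 (-1)) (by
    intro x y h
    cases h <;>
      simp [monomialAction_mul, monomialAction_zero, lam_ne_zero])

theorem regularRep_monomial (α β : ℤ) :
    regularRep θ (monomial θ α β) = monomialAction θ α β := by
  have rep_V : regularRep θ (V θ ^ α : (Torus θ)ˣ) = monomialAction θ α 0 :=
    map_units_zpow_of_map_add (regularRep θ : Torus θ →* _) (s := fun n => monomialAction θ n 0)
      (monomialAction_zero θ) (fun m n => by simp [monomialAction_mul]) (lift_gen θ _ _ Gen.V) α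
  have rep_W : regularRep θ (W θ ^ β : (Torus θ)ˣ) = monomialAction θ 0 β :=
    map_units_zpow_of_map_add (regularRep θ : Torus θ →* _) (s := fun n => monomialAction θ 0 n)
      (monomialAction_zero θ) (fun m n => by simp [monomialAction_mul]) (lift_gen θ _ _ Gen.W) β
  rw [monomial, Units.val_mul, map_mul, rep_V, rep_W, monomialAction_mul]
  simp

theorem linearIndependent_monomial :
    LinearIndependent ℂ fun p : ℤ × ℤ => monomial θ p.1 p.2 := by
  let evalAtOne : Torus θ →ₗ[ℂ] ℤ × ℤ →₀ ℂ :=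
    (LinearMap.applyₗ (Finsupp.single (0, 0) 1)).comp (regularRep θ).toLinearMap
  refine LinearIndependent.of_comp evalAtOne ?_
  have evalAtOne_monomial :
      (evalAtOne ∘ fun p : ℤ × ℤ => monomial θ p.1 p.2) = Finsupp.basisSingleOne := by
    ext1 p
    simp [evalAtOne, regularRep_monomial, monomialAction_single]
  rw [evalAtOne_monomial]
  exact Finsupp.basisSingleOne.linearIndependent

/-- The basis `V^α W^β` of the noncommutative torus, indexed by `(α, β)`. -/
def monomialBasis : Module.Basis (ℤ × ℤ) ℂ (Torus θ) :=
  .mk (linearIndependent_monomial θ) (span_monomial θ).ge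

theorem monomialBasis_apply (p : ℤ × ℤ) : monomialBasis θ p = monomial θ p.1 p.2 :=
  Module.Basis.mk_apply _ _ _

end Monomials

section Traces

variable (θ : ℝ)

/-- The prescribed value of the twisted trace `τ̂_ij` at `V^α W^β`. -/
def traceValue (i j : ZMod 2) (α β : ℤ) : ℂ :=
  if (α : ZMod 2) = i ∧ (β : ZMod 2) = j then
    Complex.exp (Real.pi * Complex.I * θ * α * β) else 0

/-- The twisted trace `τ̂_ij`, defined by its values on the basis of monomials. -/
def twistedTrace (i j : ZMod 2) : Torus θ →ₗ[ℂ] ℂ :=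
  (monomialBasis θ).constr ℂ fun p => traceValue θ i j p.1 p.2

theorem twistedTrace_monomial (i j : ZMod 2) (α β : ℤ) :
    twistedTrace θ i j (monomial θ α β) = traceValue θ i j α β := by
  rw [← monomialBasis_apply θ (α, β)]
  exact (monomialBasis θ).constr_basis ℂ _ _

theorem hasTraceValues_twistedTrace (i j : ZMod 2) :
    HasTraceValues θ i j (twistedTrace θ i j) :=
  twistedTrace_monomial θ i j

variable {θ} in
theorem HasTraceValues.eq_twistedTrace {i j : ZMod 2} {τ : Torus θ →ₗ[ℂ] ℂ}
    (h : HasTraceValues θ i j τ) : τ = twistedTrace θ i j :=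
  (monomialBasis θ).ext fun p => by
    rw [monomialBasis_apply, twistedTrace_monomial]
    exact h p.1 p.2

theorem lam_zpow_mul_traceValue (i j : ZMod 2) (a b c d : ℤ) :
    lam θ ^ (-(c * b)) * traceValue θ i j (a + c) (b + d)
      = lam θ ^ (-(a * -d)) * traceValue θ i j (-c + a) (-d + b) := by
  have parity (m n : ℤ) : ((-n + m : ℤ) : ZMod 2) = ((m + n : ℤ) : ZMod 2) := by
    push_cast
    rw [ZMod.neg_eq_self_mod_two, add_comm]
  simp only [traceValue, parity]
  split_ifs
  · -- `λ` is the square of the number `exp(πiθ)` occurring in `traceValue`.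
    simp only [lam_zpow, ← Complex.exp_add]
    congr 1
    push_cast
    ring
  · simp only [mul_zero]

theorem twistedTrace_mul (i j : ZMod 2) (x y : Torus θ) :
    twistedTrace θ i j (x * y) = twistedTrace θ i j (sigma θ y * x) := by
  let μ := LinearMap.mul ℂ (Torus θ)
  suffices μ.compr₂ (twistedTrace θ i j)
      = (μ.flip.compl₂ (sigma θ).toLinearMap).compr₂ (twistedTrace θ i j) from
    LinearMap.congr_fun₂ this x y
  refine (monomialBasis θ).ext fun ⟨a, b⟩ => (monomialBasis θ).ext fun ⟨c, d⟩ => ?_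
  simp only [μ, monomialBasis_apply, LinearMap.compr₂_apply, LinearMap.mul_apply',
    LinearMap.compl₂_apply, LinearMap.flip_apply, AlgHom.toLinearMap_apply, sigma_monomial,
    monomial_mul_monomial, map_smul, twistedTrace_monomial, smul_eq_mul]
  exact lam_zpow_mul_traceValue θ i j a b c d

theorem twistedTrace_one (i j : ZMod 2) :
    twistedTrace θ i j 1 = if 0 = i ∧ 0 = j then 1 else 0 := by
  rw [← monomial_zero, twistedTrace_monomial]
  simp [traceValue]

/-- The restriction of the twisted trace `τ̂₀₀` to the pillow algebra, where it is a trace. -/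
def pillowTrace : Pillow θ →+ ℂ :=
  (twistedTrace θ 0 0 ∘ₗ (Pillow θ).val.toLinearMap).toAddMonoidHom

theorem pillowTrace_apply (p : Pillow θ) : pillowTrace θ p = twistedTrace θ 0 0 p := rfl

theorem pillowTrace_mul_comm (p q : Pillow θ) : pillowTrace θ (p * q) = pillowTrace θ (q * p) := by
  rw [pillowTrace_apply, pillowTrace_apply, MulMemClass.coe_mul, twistedTrace_mul,
    mem_pillow.1 q.2, MulMemClass.coe_mul]

theorem pillowTrace_one : pillowTrace θ 1 = 1 := by
  simp [pillowTrace_apply, twistedTrace_one]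

end Traces

section OddPart

variable {θ : ℝ}

theorem coe_smul_odd (p : Pillow θ) (a : OddPart θ) :
    ((p • a : OddPart θ) : Torus θ) = (p : Torus θ) * (a : Torus θ) := rfl

theorem coe_op_smul_odd (p : (Pillow θ)ᵐᵒᵖ) (a : OddPart θ) :
    ((p • a : OddPart θ) : Torus θ) = (a : Torus θ) * (p.unop : Torus θ) := rfl

theorem coe_oddMul (a b : OddPart θ) :
    (oddMul a b : Torus θ) = (a : Torus θ) * (b : Torus θ) := rfl

theorem coe_xHat : (xHat θ : Torus θ) = monomial θ 1 0 - monomial θ (-1) 0 := by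
  simp [xHat, monomial]

theorem coe_yHat : (yHat θ : Torus θ) = monomial θ 0 1 - monomial θ 0 (-1) := by
  simp [yHat, monomial]

theorem coe_zHat : (zHat θ : Torus θ) = monomial θ 1 (-1) - monomial θ (-1) 1 := by
  simp [zHat, monomial]

theorem coe_z : (z θ : Torus θ) = monomial θ 1 (-1) + monomial θ (-1) 1 := by
  simp [z, monomial]

theorem xHat_mul_xHat :
    (xHat θ * xHat θ : Torus θ) = monomial θ 2 0 + monomial θ (-2) 0 - (2 : ℂ) • 1 := by
  simp only [coe_xHat, Int.reduceNeg, mul_sub, sub_mul, monomial_mul_monomial, mul_zero, neg_zero,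
    zpow_ofNat, pow_zero, Int.reduceAdd, add_zero, one_smul, neg_add_cancel, monomial_zero,
    add_neg_cancel]
  module

theorem yHat_mul_yHat :
    (yHat θ * yHat θ : Torus θ) = monomial θ 0 2 + monomial θ 0 (-2) - (2 : ℂ) • 1 := by
  simp only [coe_yHat, Int.reduceNeg, mul_sub, sub_mul, monomial_mul_monomial, mul_one, neg_zero,
    zpow_ofNat, pow_zero, add_zero, Int.reduceAdd, one_smul, mul_neg, neg_add_cancel,
    monomial_zero, add_neg_cancel]
  module

theorem zHat_mul_zHat :
    (zHat θ * zHat θ : Torus θ)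
      = lam θ • (monomial θ 2 (-2) + monomial θ (-2) 2) - (2 * (lam θ)⁻¹) • 1 := by
  simp only [coe_zHat, Int.reduceNeg, mul_sub, sub_mul, monomial_mul_monomial, mul_neg, mul_one,
    neg_neg, zpow_ofNat, pow_one, Int.reduceAdd, zpow_neg, neg_add_cancel, add_neg_cancel,
    monomial_zero, smul_add]
  module

theorem xHat_mul_z_mul_yHat :
    (xHat θ * z θ * yHat θ : Torus θ)
      = monomial θ 2 0 + monomial θ (-2) 0 + (monomial θ 0 2 + monomial θ 0 (-2))
        - (monomial θ 2 (-2) + monomial θ (-2) 2) - (2 : ℂ) • 1 := by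
  simp only [coe_xHat, Int.reduceNeg, coe_z, mul_add, sub_mul, monomial_mul_monomial, mul_zero,
    neg_zero, zpow_ofNat, pow_zero, Int.reduceAdd, zero_add, one_smul, neg_add_cancel,
    add_neg_cancel, coe_yHat, mul_sub, add_mul, mul_neg, mul_one, add_zero, monomial_zero]
  module

theorem sum_row_mul_col :
    ∑ k, (row θ k * col θ k : Torus θ) = (2 * ((starRingEnd ℂ) (lam θ) ^ 2 - 1)) • 1 := by
  have sum_eq : ∑ k, (row θ k * col θ k : Torus θ)
      = xHat θ * xHat θ + yHat θ * yHat θ - xHat θ * z θ * yHat θ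
        - (lam θ)⁻¹ • (zHat θ * zHat θ : Torus θ) := by
    simp only [row, conj_lam, col, Fin.sum_univ_three, Matrix.cons_val_zero, Matrix.cons_val_one,
      Matrix.cons_val, AddSubgroupClass.coe_sub, NegMemClass.coe_neg, SetLike.val_smul,
      coe_op_smul_odd, MulOpposite.unop_op, sub_mul, neg_mul, smul_mul_assoc]
    abel
  rw [sum_eq, xHat_mul_xHat, yHat_mul_yHat, xHat_mul_z_mul_yHat, zHat_mul_zHat, conj_lam, smul_sub,
    smul_smul, smul_smul, inv_mul_cancel₀ (lam_ne_zero θ)]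
  module

end OddPart

section Idempotent

variable {θ : ℝ}

variable (θ) in
/-- The row `(x̂, ŷ - x̂ z, -λ̄ ẑ)` divided by `2 (λ̄² - 1)`, so that `e` is the product of the
column `col` and this row. -/
def normRow (j : Fin 3) : OddPart θ := (1 / (2 * ((starRingEnd ℂ) (lam θ) ^ 2 - 1))) • row θ j

theorem e_apply (i j : Fin 3) : e θ i j = oddMul (col θ i) (normRow θ j) :=
  Subtype.ext (mul_smul_comm _ _ _).symm

theorem sum_normRow_mul_col (hθ : lam θ ^ 2 ≠ 1) : ∑ k, (normRow θ k * col θ k : Torus θ) = 1 := by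
  have scalar_ne_zero : 2 * ((starRingEnd ℂ) (lam θ) ^ 2 - 1) ≠ 0 := by
    simpa [conj_lam, sub_eq_zero] using hθ
  simp only [normRow, Submodule.coe_smul, smul_mul_assoc]
  rw [← Finset.smul_sum, sum_row_mul_col, smul_smul, one_div_mul_cancel scalar_ne_zero, one_smul]

/-- Right multiplication `a ↦ a b` by an odd element, as a map of left modules. -/
def mulRight (b : OddPart θ) : OddPart θ →ₗ[Pillow θ] Pillow θ where
  toFun a := oddMul a b
  map_add' _ _ := Subtype.ext (add_mul _ _ _)
  map_smul' _ _ := Subtype.ext (mul_assoc _ _ _)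

/-- Left multiplication `a ↦ b a` by an odd element, as a map of right modules. -/
def mulLeft (b : OddPart θ) : OddPart θ →ₗ[(Pillow θ)ᵐᵒᵖ] Pillow θ where
  toFun a := oddMul b a
  map_add' _ _ := Subtype.ext (mul_add _ _ _)
  map_smul' _ _ := Subtype.ext (mul_assoc _ _ _).symm

theorem mulRight_apply (a b : OddPart θ) : mulRight b a = oddMul a b := rfl

theorem mulLeft_apply (a b : OddPart θ) : mulLeft b a = oddMul b a := rfl

theorem sum_oddMul_normRow_smul_col (hθ : lam θ ^ 2 ≠ 1) (a : OddPart θ) :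
    ∑ k, oddMul a (normRow θ k) • col θ k = a := by
  ext
  simp only [Submodule.coe_sum, coe_smul_odd, coe_oddMul, mul_assoc]
  rw [← Finset.mul_sum, sum_normRow_mul_col hθ, mul_one]

theorem sum_op_oddMul_col_smul_normRow (hθ : lam θ ^ 2 ≠ 1) (a : OddPart θ) :
    ∑ k, MulOpposite.op (oddMul (col θ k) a) • normRow θ k = a := by
  ext
  simp only [Submodule.coe_sum, coe_op_smul_odd, MulOpposite.unop_op, coe_oddMul, ← mul_assoc]
  rw [← Finset.sum_mul, sum_normRow_mul_col hθ, one_mul]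

theorem isDualBasis_left (hθ : lam θ ^ 2 ≠ 1) :
    IsDualBasis (col θ) fun k => mulRight (normRow θ k) :=
  sum_oddMul_normRow_smul_col hθ

theorem isDualBasis_right (hθ : lam θ ^ 2 ≠ 1) :
    IsDualBasis (normRow θ) fun k =>
      (MulOpposite.opLinearEquiv (Pillow θ)ᵐᵒᵖ).toLinearMap ∘ₗ mulLeft (col θ k) :=
  sum_op_oddMul_col_smul_normRow hθ

theorem e_mul_e (hθ : lam θ ^ 2 ≠ 1) : e θ * e θ = e θ := by
  ext i j
  calc ((e θ * e θ) i j : Torus θ)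
      = col θ i * (∑ k, (normRow θ k * col θ k : Torus θ)) * normRow θ j := by
        simp [Matrix.mul_apply, e_apply, coe_oddMul, Finset.mul_sum, Finset.sum_mul, mul_assoc]
    _ = e θ i j := by rw [sum_normRow_mul_col hθ, mul_one, e_apply, coe_oddMul]

theorem vecMul_e (v : Fin 3 → Pillow θ) :
    Matrix.vecMul v (e θ)
      = LinearMap.pi (fun j => mulRight (normRow θ j)) (∑ i, v i • col θ i) := by
  ext j
  simp [Matrix.vecMul, dotProduct, e_apply, mulRight_apply]

theorem mulVec_e (v : Fin 3 → Pillow θ) :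
    Matrix.mulVec (e θ) v
      = LinearMap.pi (fun i => mulLeft (col θ i)) (∑ j, MulOpposite.op (v j) • normRow θ j) := by
  ext i
  simp [Matrix.mulVec, dotProduct, e_apply, mulLeft_apply]

theorem nonempty_linearEquiv_leftImage (hθ : lam θ ^ 2 ≠ 1) :
    Nonempty (OddPart θ ≃ₗ[Pillow θ] leftImage θ) :=
  nonempty_linearEquiv_of_leftInverse (f := LinearMap.pi fun k => mulRight (normRow θ k))
    (g := fun v => ∑ i, v i • col θ i) (sum_oddMul_normRow_smul_col hθ) fun w => by
      simp only [← vecMul_e]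
      rfl

theorem nonempty_linearEquiv_rightImage (hθ : lam θ ^ 2 ≠ 1) :
    Nonempty (OddPart θ ≃ₗ[(Pillow θ)ᵐᵒᵖ] rightImage θ) :=
  nonempty_linearEquiv_of_leftInverse (f := LinearMap.pi fun k => mulLeft (col θ k))
    (g := fun v => ∑ j, MulOpposite.op (v j) • normRow θ j) (sum_op_oddMul_col_smul_normRow hθ)
    fun w => by
      simp only [← mulVec_e]
      rfl

theorem twistedTrace_trace_e (hθ : lam θ ^ 2 ≠ 1) (i j : ZMod 2) :
    twistedTrace θ i j (Matrix.trace (e θ) : Pillow θ) = if 0 = i ∧ 0 = j then -1 else 0 := by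
  have swap (k : Fin 3) : twistedTrace θ i j (col θ k * normRow θ k : Torus θ)
      = -twistedTrace θ i j (normRow θ k * col θ k : Torus θ) := by
    rw [twistedTrace_mul, mem_odd.1 (normRow θ k).2, neg_mul, map_neg]
  calc twistedTrace θ i j (Matrix.trace (e θ) : Pillow θ)
      = ∑ k, twistedTrace θ i j (col θ k * normRow θ k : Torus θ) := by
        simp [Matrix.trace, e_apply, coe_oddMul]
    _ = -twistedTrace θ i j (∑ k, (normRow θ k * col θ k : Torus θ)) := by
        simp only [swap, Finset.sum_neg_distrib, map_sum]
    _ = if 0 = i ∧ 0 = j then -1 else 0 := by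
        rw [sum_normRow_mul_col hθ, twistedTrace_one, neg_ite, neg_zero]

open scoped ComplexOrder in
theorem sum_pillowTrace_neg (hθ : lam θ ^ 2 ≠ 1) :
    ∑ k, pillowTrace θ (oddMul (col θ k) (normRow θ k)) < 0 := by
  have trace_e : pillowTrace θ (Matrix.trace (e θ)) = -1 := by
    simp [pillowTrace_apply, twistedTrace_trace_e hθ]
  simp only [Matrix.trace, map_sum, Matrix.diag_apply, e_apply] at trace_e
  simp [trace_e]

open scoped ComplexOrder in
theorem not_free_left (hθ : lam θ ^ 2 ≠ 1) :
    ¬ Module.Free (Pillow θ) (OddPart θ) ∧ ¬ Module.Free (Pillow θ) (Omega1 θ) := by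
  have t_one : 0 ≤ pillowTrace θ 1 := by simp [pillowTrace_one]
  exact ⟨(isDualBasis_left hθ).not_free_of_sum_trace_neg (pillowTrace_mul_comm θ) t_one
      (sum_pillowTrace_neg hθ),
    (isDualBasis_left hθ).not_free_prod_of_sum_trace_neg (pillowTrace_mul_comm θ) t_one
      (sum_pillowTrace_neg hθ)⟩

open scoped ComplexOrder in
theorem not_free_right (hθ : lam θ ^ 2 ≠ 1) :
    ¬ Module.Free (Pillow θ)ᵐᵒᵖ (OddPart θ) ∧ ¬ Module.Free (Pillow θ)ᵐᵒᵖ (Omega1 θ) := by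
  let t : (Pillow θ)ᵐᵒᵖ →+ ℂ := (pillowTrace θ).comp MulOpposite.opAddEquiv.symm.toAddMonoidHom
  have t_mul_comm (p q : (Pillow θ)ᵐᵒᵖ) : t (p * q) = t (q * p) :=
    pillowTrace_mul_comm θ q.unop p.unop
  have t_one : 0 ≤ t 1 := (pillowTrace_one θ).symm ▸ zero_le_one
  exact ⟨(isDualBasis_right hθ).not_free_of_sum_trace_neg t_mul_comm t_one
      (sum_pillowTrace_neg hθ),
    (isDualBasis_right hθ).not_free_prod_of_sum_trace_neg t_mul_comm t_one
      (sum_pillowTrace_neg hθ)⟩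

end Idempotent

end

end NCPillow

open NCPillow in
theorem proposition3p4_general (θ : ℝ) (hθ : lam θ ^ 2 ≠ 1) :
    (Module.Finite (Pillow θ) (OddPart θ) ∧ Module.Projective (Pillow θ) (OddPart θ) ∧
      ¬ Module.Free (Pillow θ) (OddPart θ)) ∧
    (Module.Finite (Pillow θ)ᵐᵒᵖ (OddPart θ) ∧ Module.Projective (Pillow θ)ᵐᵒᵖ (OddPart θ) ∧
      ¬ Module.Free (Pillow θ)ᵐᵒᵖ (OddPart θ)) ∧
    (e θ * e θ = e θ ∧ Nonempty (OddPart θ ≃ₗ[Pillow θ] leftImage θ) ∧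
      Nonempty (OddPart θ ≃ₗ[(Pillow θ)ᵐᵒᵖ] rightImage θ)) ∧
    (∃ τ : ZMod 2 → ZMod 2 → (Torus θ →ₗ[ℂ] ℂ),
      (∀ i j, HasTraceValues θ i j (τ i j) ∧ ∀ τ', HasTraceValues θ i j τ' → τ' = τ i j) ∧
      (∀ i j a b, τ i j (a * b) = τ i j (sigma θ b * a)) ∧
      τ 0 0 (Matrix.trace (e θ) : Pillow θ) = -1 ∧
      τ 0 1 (Matrix.trace (e θ) : Pillow θ) = 0 ∧
      τ 1 0 (Matrix.trace (e θ) : Pillow θ) = 0 ∧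
      τ 1 1 (Matrix.trace (e θ) : Pillow θ) = 0) ∧
    ¬ Module.Free (Pillow θ) (Omega1 θ) ∧ ¬ Module.Free (Pillow θ)ᵐᵒᵖ (Omega1 θ) := by
  have left := isDualBasis_left hθ
  have right := isDualBasis_right hθ
  refine ⟨⟨left.finite, left.projective, (not_free_left hθ).1⟩,
    ⟨right.finite, right.projective, (not_free_right hθ).1⟩,
    ⟨e_mul_e hθ, nonempty_linearEquiv_leftImage hθ, nonempty_linearEquiv_rightImage hθ⟩,
    ⟨twistedTrace θ,
      fun i j => ⟨hasTraceValues_twistedTrace θ i j, fun _ => HasTraceValues.eq_twistedTrace⟩,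
      twistedTrace_mul θ, ?_, ?_, ?_, ?_⟩,
    (not_free_left hθ).2, (not_free_right hθ).2⟩
  all_goals simp [twistedTrace_trace_e hθ]

open NCPillow in
theorem proposition3p4 (θ : ℝ) (hθ : Irrational θ) :
    -- the odd part is finitely generated projective and not free, as a left and a right module
    (Module.Finite (Pillow θ) (OddPart θ) ∧ Module.Projective (Pillow θ) (OddPart θ) ∧
      ¬ Module.Free (Pillow θ) (OddPart θ)) ∧
    (Module.Finite (Pillow θ)ᵐᵒᵖ (OddPart θ) ∧ Module.Projective (Pillow θ)ᵐᵒᵖ (OddPart θ) ∧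
      ¬ Module.Free (Pillow θ)ᵐᵒᵖ (OddPart θ)) ∧
    -- the idempotent `e` represents the odd part
    (e θ * e θ = e θ ∧ Nonempty (OddPart θ ≃ₗ[Pillow θ] leftImage θ) ∧
      Nonempty (OddPart θ ≃ₗ[(Pillow θ)ᵐᵒᵖ] rightImage θ)) ∧
    -- the four twisted traces and their values on the matrix trace of `e`
    (∃ τ : ZMod 2 → ZMod 2 → (Torus θ →ₗ[ℂ] ℂ),
      (∀ i j, HasTraceValues θ i j (τ i j) ∧ ∀ τ', HasTraceValues θ i j τ' → τ' = τ i j) ∧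
      (∀ i j a b, τ i j (a * b) = τ i j (sigma θ b * a)) ∧
      τ 0 0 (Matrix.trace (e θ) : Pillow θ) = -1 ∧
      τ 0 1 (Matrix.trace (e θ) : Pillow θ) = 0 ∧
      τ 1 0 (Matrix.trace (e θ) : Pillow θ) = 0 ∧
      τ 1 1 (Matrix.trace (e θ) : Pillow θ) = 0) ∧
    -- the module of one-forms is not free on either side
    ¬ Module.Free (Pillow θ) (Omega1 θ) ∧ ¬ Module.Free (Pillow θ)ᵐᵒᵖ (Omega1 θ) := by
  exact proposition3p4_general θ (lam_sq_ne_one hθ)
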